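/- Let $q$ be a positive integer and let $\alpha_1,\dots,\alpha_q$ be positive constants with $\alpha_1+\cdots+\alpha_q=1$; put $\alpha_{\min}=\min\{\alpha_i : 1\le i\le q\}$. Let $G=G_{n,n,p}$ be the random bipartite graph with two vertex classes of size $n$ in which each of the $n^2$ possible edges is present independently with probability $p=p(n)\in[0,1]$, and colour the edges of $G$ independently with colours $c_1,\dots,c_q$, an edge receiving colour $c_i$ with probability $\alpha_i$. Let the perfect matching colour profile $\mathrm{mcp}(G)$ be the set of all vectors $(m_1,\dots,m_q)$ of nonnegative integers such that $G$ has a perfect matching with exactly $m_i$ edges of colour $c_i$ for every $i$, and let $\mathcal{F}_n$ be the event $$\mathrm{mcp}(G)=\{(m_1,\dots,m_q)\in\{0,1,\dots,n\}^q : m_1+\cdots+m_q=n\}.$$ (a) If $p=\dfrac{\log n+\omega}{\alpha_{\min}n}$ for all large $n$, where $\omega=\omega(n)\to\infty$ and $\omega=o(\log n)$, then $\mathbb{P}(\mathcal{F}_n)\to1$ as $n\to\infty$; that is, w.h.p. for every vector of nonnegative integers $(m_1,\dots,m_q)$ with $m_1+\cdots+m_q=n$ there is a perfect matching with exactly $m_i$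 edges of colour $c_i$ for all $i$. (b) Consequently $p=\log n/(\alpha_{\min}n)$ is the threshold for $\mathcal{F}_n$, in the following sense: $\mathbb{P}(\mathcal{F}_n)\to1$ whenever $\alpha_{\min}np-\log n\to\infty$, and $\mathbb{P}(\mathcal{F}_n)\to0$ whenever $\alpha_{\min}np-\log n\to-\infty$. -/

import Mathlib

open MeasureTheory ProbabilityTheory Filter Topology Asymptotics
open scoped ENNReal unitInterval

namespace MatchingProfile

/-- A colored bipartite graph on two vertex classes `A`, `B`, both indexed by `Fin n`, with `q`
colors. The edge set is a set of pairs `(a, b)` with `a ∈ A` and `b ∈ B`; a color is attached to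
every pair, but only the colors of pairs that are edges are ever used. -/
abbrev ColoredBipartite (n q : ℕ) : Type :=
  Set (Fin n × Fin n) × (Fin n × Fin n → Fin q)

/-- `M` is a perfect matching of the bipartite graph with edge set `E`: it consists of edges of
the graph, and every vertex of `A` and every vertex of `B` lies in exactly one edge of `M`. -/
def IsPerfectMatching {n : ℕ} (E : Set (Fin n × Fin n)) (M : Finset (Fin n × Fin n)) : Prop :=
  (∀ e ∈ M, e ∈ E) ∧ (∀ a, ∃! b, (a, b) ∈ M) ∧ (∀ b, ∃! a, (a, b) ∈ M)

/-- The perfect matching color profile of a colored bipartite graph: all vectors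
`(m 1, …, m q)` of nonnegative integers such that some perfect matching has exactly `m i` edges
of color `i`, for every `i`. -/
def mcp {n q : ℕ} (G : ColoredBipartite n q) : Set (Fin q → ℕ) :=
  {m | ∃ M : Finset (Fin n × Fin n), IsPerfectMatching G.1 M ∧
    ∀ i, (M.filter fun e => G.2 e = i).card = m i}

/-- The event that every vector of nonnegative integers with sum `n` lies in the profile, and
nothing else does. -/
def fullProfile (n q : ℕ) : Set (ColoredBipartite n q) :=
  {G | mcp G = {m : Fin q → ℕ | ∑ i, m i = n}}

/-- The law of the color of one edge: color `i` has probability `α i`. -/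
noncomputable def colorLaw {q : ℕ} (α : Fin q → ℝ) : Measure (Fin q) :=
  ∑ i, ENNReal.ofReal (α i) • Measure.dirac i

/-- The law of the randomly colored random bipartite graph `G_{n,n,p}`: each of the `n²` pairs is
an edge independently with probability `p`, and, independently of that and of each other, the
edges receive colors with law `colorLaw α`. -/
noncomputable def coloredGnnp {q : ℕ} (n : ℕ) (p : I) (α : Fin q → ℝ) :
    Measure (ColoredBipartite n q) :=
  (setBernoulli (Set.univ : Set (Fin n × Fin n)) p).prod (Measure.pi fun _ => colorLaw α)

end MatchingProfile

/-! The edges of color `i` form a random bipartite graph of density `p * α i`. A full profile needs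
a perfect matching inside every color, so the rarest color dictates the threshold. Conversely,
monochromatic matchings suffice once every color class is hole-free: any two sets of `s` vertices,
one in each class, span an edge of that color, with `s` about `n / (4 * q)`.

The reason is a switching argument. Given a perfect matching `ρ`, draw an arc `a → b` of color `k`
when `(a, ρ b)` is an edge of color `k`. Among at least `3 * s` vertices matched in color `i`,
hole-freeness yields a directed cycle with one arc of color `j` and all others of color `i`;
rotating `ρ` along it recolors exactly one matching edge (`exists_switch`). By pigeonhole every
profile has a color used at least `3 * s` times, and it is reached by switches from the
monochromatic matching in that color (`mem_fullProfile`).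

Hole-freeness and the monochromatic matchings come from first moments. In a hole-free graph a
failure of Hall's condition produces a small minimal obstruction on one side; isolated vertices
contribute at most `n * exp (-(n * r))` per side, with `r = p * α i`, and larger obstructions a
geometric tail. Below the threshold, w.h.p. the rarest color leaves a vertex isolated. -/

namespace MatchingProfile

/-! ### Cycles with one exceptional arc in hole-free digraphs -/

section Digraph

variable {V : Type*}

/-- Any two sets of at least `s` vertices are joined by a pair in the relation `r`. -/
def HoleFree (r : V → V → Prop) (s : ℕ) : Prop :=
  ∀ S T : Finset V, s ≤ S.card → s ≤ T.card → ∃ a ∈ S, ∃ b ∈ T, r a b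

/-- Inside a set of at least `3 * s` vertices, two hole-free relations `r` and `t` produce a closed
walk that uses a single `t`-arc and otherwise only `r`-arcs. -/
theorem exists_arc_reflTransGen {r t : V → V → Prop} {s : ℕ} (hs : 0 < s) {K : Finset V}
    (hr : ∀ S T : Finset V, S ⊆ K → T ⊆ K → s ≤ S.card → s ≤ T.card → ∃ a ∈ S, ∃ b ∈ T, r a b)
    (ht : ∀ S T : Finset V, S ⊆ K → T ⊆ K → s ≤ S.card → s ≤ T.card → ∃ a ∈ S, ∃ b ∈ T, t a b)
    (hK : 3 * s ≤ K.card) :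
    ∃ e ∈ K, ∃ f ∈ K, t e f ∧
      Relation.ReflTransGen (fun a b => a ∈ K ∧ b ∈ K ∧ r a b) f e := by
  classical
  let C : Finset V → Prop := fun U => U ⊆ K ∧ ∀ a ∈ U, ∀ b ∈ K, r a b → b ∈ U
  -- A closed set sends no `r`-arc to the rest of `K`, so the two cannot both have `s` elements.
  have hC : ∀ U, C U → U.card < s ∨ K.card < U.card + s := by
    intro U hU
    by_contra! h
    have h1 : s ≤ (K \ U).card := by
      rw [Finset.card_sdiff_of_subset hU.1]; omega
    obtain ⟨a, ha, b, hb, hab⟩ := hr U (K \ U) hU.1 Finset.sdiff_subset h.1 h1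
    rw [Finset.mem_sdiff] at hb
    exact hb.2 (hU.2 a ha b hb.1 hab)
  -- `U` is a largest small closed set and `U'` a smallest closed set strictly above it. Maximality
  -- makes `U'` big, so `U' \ U` has room for a `t`-arc.
  obtain ⟨U, hU, hUmax⟩ := Finset.exists_max_image
    (K.powerset.filter fun U => C U ∧ U.card < s) Finset.card
    ⟨∅, by simp [C, hs]⟩
  rw [Finset.mem_filter] at hU
  obtain ⟨U', hU', hUmin⟩ := Finset.exists_min_image
    (K.powerset.filter fun W => C W ∧ U ⊂ W) Finset.card
    ⟨K, by
      simp only [Finset.mem_filter, Finset.mem_powerset, subset_refl, true_and]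
      refine ⟨⟨subset_refl _, fun a _ b hb _ => hb⟩, ?_⟩
      refine Finset.ssubset_iff_subset_ne.2 ⟨hU.2.1.1, ?_⟩
      rintro rfl
      have := hU.2.2
      omega⟩
  rw [Finset.mem_filter] at hU'
  have hbig : K.card < U'.card + s := by
    refine (hC U' hU'.2.1).resolve_left fun h => ?_
    have := hUmax U' (Finset.mem_filter.2 ⟨hU'.1, hU'.2.1, h⟩)
    have := Finset.card_lt_card hU'.2.2
    omega
  have hD : s ≤ (U' \ U).card := by
    rw [Finset.card_sdiff_of_subset hU'.2.2.1]
    have := hU.2.2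
    omega
  have hDK : U' \ U ⊆ K := Finset.sdiff_subset.trans hU'.2.1.1
  obtain ⟨e, he, f, hf, hef⟩ := ht _ _ hDK hDK hD hD
  refine ⟨e, hDK he, f, hDK hf, hef, ?_⟩
  rw [Finset.mem_sdiff] at he hf
  -- `W` is closed and lies between `U` and `U'`, so minimality of `U'` forces `W = U'`. Since `e`
  -- is not in `U`, it is reachable from `f`.
  let W := U ∪ K.filter fun b => Relation.ReflTransGen (fun a b => a ∈ K ∧ b ∈ K ∧ r a b) f b
  have hfW : f ∈ W := by
    simp only [W, Finset.mem_union, Finset.mem_filter]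
    exact Or.inr ⟨hU'.2.1.1 hf.1, .refl⟩
  have hW : C W := by
    refine ⟨Finset.union_subset hU.2.1.1 (Finset.filter_subset _ _), fun a ha b hb hab => ?_⟩
    simp only [W, Finset.mem_union, Finset.mem_filter] at ha ⊢
    rcases ha with ha | ha
    · exact Or.inl (hU.2.1.2 a ha b hb hab)
    · exact Or.inr ⟨hb, ha.2.tail ⟨ha.1, hb, hab⟩⟩
  have hUW : U ⊂ W := Finset.ssubset_iff_subset_ne.2
    ⟨Finset.subset_union_left, fun h => hf.2 (h ▸ hfW)⟩
  have hWU' : W ⊆ U' := by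
    refine Finset.union_subset hU'.2.2.1 fun b hb => ?_
    have hb := (Finset.mem_filter.1 hb).2
    induction hb with
    | refl => exact hf.1
    | tail _ h ih => exact hU'.2.1.2 _ (ih (by simp [h.1, *])) _ h.2.1 h.2.2
  have hcard := hUmin W (Finset.mem_filter.2 ⟨Finset.mem_powerset.2 hW.1, hW, hUW⟩)
  have heW : e ∈ W := by
    rw [Finset.eq_of_subset_of_card_le hWU' hcard]; exact he.1
  simp only [W, Finset.mem_union, Finset.mem_filter, he.2, false_or] at heW
  exact heW.2

/-- When a new head already occurs on the path, the path is cut back to that occurrence. -/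
theorem exists_nodup_isChain {r : V → V → Prop} {f e : V} (h : Relation.ReflTransGen r f e) :
    ∃ l : List V, (f :: l).Nodup ∧ (f :: l).IsChain r ∧ (f :: l).getLast (by simp) = e := by
  classical
  induction h using Relation.ReflTransGen.head_induction_on with
  | refl => exact ⟨[], by simp⟩
  | @head a b hab _ ih =>
    obtain ⟨l, hl, hc, hlast⟩ := ih
    by_cases ha : a ∈ b :: l
    · obtain ⟨l₁, l₂, h⟩ := List.append_of_mem ha
      have hsuf : a :: l₂ <:+ b :: l := ⟨l₁, h.symm⟩
      refine ⟨l₂, hl.sublist hsuf.sublist, hc.suffix hsuf, ?_⟩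
      rw [← hlast]
      simp [h]
    · refine ⟨b :: l, List.nodup_cons.2 ⟨ha, hl⟩, List.isChain_cons_cons.2 ⟨hab, hc⟩, ?_⟩
      rw [List.getLast_cons (by simp), hlast]

/-- Adding the head `x` composes with `swap x y`, which changes only the images of `x` and of the
last entry. -/
theorem formPerm_isChain [DecidableEq V] {r : V → V → Prop} (l : List V) :
    ∀ x : V, (x :: l).Nodup → (x :: l).IsChain r →
      ∀ z, z ≠ (x :: l).getLast (by simp) →
        (x :: l).formPerm z = z ∨ r z ((x :: l).formPerm z) := by
  induction l with
  | nil => intro x _ _ z _; simp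
  | cons y l ih =>
    intro x hn hc z hz
    rw [List.isChain_cons_cons] at hc
    rw [List.getLast_cons (by simp)] at hz
    have hx := (List.nodup_cons.1 hn).1
    rw [List.formPerm_cons_cons, Equiv.Perm.mul_apply]
    by_cases hzx : z = x
    · subst hzx
      rw [List.formPerm_apply_of_notMem hx, Equiv.swap_apply_left]
      exact Or.inr hc.1
    · have h1 : (y :: l).formPerm z ≠ x := fun h => hzx <| by
        rw [← List.formPerm_apply_of_notMem hx] at h
        exact Equiv.injective _ h
      have h2 : (y :: l).formPerm z ≠ y := fun h => hz <|
        Equiv.injective _ (h.trans (List.formPerm_apply_getLast y l).symm)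
      rw [Equiv.swap_apply_of_ne_of_ne h1 h2]
      exact ih y (List.nodup_cons.1 hn).2 hc.2 z hz

/-- A path from `f` to `e` closes up to a permutation that sends `e` to `f` and moves every other
point, if at all, along the relation. -/
theorem exists_perm_of_reflTransGen {r : V → V → Prop} {f e : V}
    (h : Relation.ReflTransGen r f e) :
    ∃ π : Equiv.Perm V, π e = f ∧ ∀ z, z ≠ e → π z = z ∨ r z (π z) := by
  classical
  obtain ⟨l, hn, hc, rfl⟩ := exists_nodup_isChain h
  exact ⟨(f :: l).formPerm, List.formPerm_apply_getLast f l, formPerm_isChain l f hn hc⟩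

end Digraph

/-! ### Recoloring one matching edge at a time -/

section Switching

variable {n q : ℕ}

/-- The relation "`(a, b)` is an edge of color `i`". -/
def colorRel (G : ColoredBipartite n q) (i : Fin q) (a b : Fin n) : Prop :=
  (a, b) ∈ G.1 ∧ G.2 (a, b) = i

/-- A perfect matching can be modified so as to recolor a single edge, from a frequent color `i`
to any other color `j`. -/
theorem exists_switch {G : ColoredBipartite n q} {s : ℕ} (hs : 0 < s)
    (hG : ∀ i, HoleFree (colorRel G i) s) {i j : Fin q} {ρ : Equiv.Perm (Fin n)}
    (hρ : ∀ a, (a, ρ a) ∈ G.1)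
    (hK : 3 * s ≤ (Finset.univ.filter fun a => G.2 (a, ρ a) = i).card) :
    ∃ τ : Equiv.Perm (Fin n), (∀ a, (a, τ a) ∈ G.1) ∧ ∃ e, G.2 (e, ρ e) = i ∧
      ∀ a, G.2 (a, τ a) = if a = e then j else G.2 (a, ρ a) := by
  -- Identifying the second class with the first through `ρ` turns each color into a digraph and
  -- preserves hole-freeness.
  have key : ∀ k, ∀ S T : Finset (Fin n), S ⊆ (Finset.univ.filter fun a => G.2 (a, ρ a) = i) →
      T ⊆ (Finset.univ.filter fun a => G.2 (a, ρ a) = i) →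
      s ≤ S.card → s ≤ T.card → ∃ a ∈ S, ∃ b ∈ T, colorRel G k a (ρ b) := by
    intro k S T _ _ hS hT
    obtain ⟨a, ha, b, hb, hab⟩ := hG k S (T.map ρ.toEmbedding) hS (by simpa using hT)
    obtain ⟨c, hc, rfl⟩ := Finset.mem_map.1 hb
    exact ⟨a, ha, c, hc, hab⟩
  obtain ⟨e, he, f, hf, hef, hfe⟩ := exists_arc_reflTransGen hs (key i) (key j) hK
  obtain ⟨π, hπe, hπ⟩ := exists_perm_of_reflTransGen hfe
  have hcol : ∀ a, a ≠ e → (a, ρ (π a)) ∈ G.1 ∧ G.2 (a, ρ (π a)) = G.2 (a, ρ a) := by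
    intro a ha
    rcases hπ a ha with h | h
    · rw [h]; exact ⟨hρ a, rfl⟩
    · simp only [Finset.mem_filter, Finset.mem_univ, true_and] at h
      exact ⟨h.2.2.1, h.2.2.2.trans h.1.symm⟩
  -- Each vertex of the cycle takes over the old partner of its successor.
  refine ⟨π.trans ρ, fun a => ?_, e, by simpa using he, fun a => ?_⟩
  · by_cases ha : a = e
    · subst ha; simpa [hπe] using hef.1
    · exact (hcol a ha).1
  · by_cases ha : a = e
    · subst ha; simpa [hπe] using hef.2
    · rw [if_neg ha]; exact (hcol a ha).2

/-- `G` has a perfect matching whose colors are counted by `m`. -/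
def HasProfile (G : ColoredBipartite n q) (m : Fin q → ℕ) : Prop :=
  ∃ ρ : Equiv.Perm (Fin n), (∀ a, (a, ρ a) ∈ G.1) ∧
    ∀ k, (Finset.univ.filter fun a => G.2 (a, ρ a) = k).card = m k

theorem HasProfile.switch {G : ColoredBipartite n q} {s : ℕ} (hs : 0 < s)
    (hG : ∀ i, HoleFree (colorRel G i) s) {i j : Fin q} (hij : i ≠ j) {m : Fin q → ℕ}
    (hm : HasProfile G m) (hi : 3 * s ≤ m i) :
    HasProfile G (m - Pi.single i 1 + Pi.single j 1) := by
  obtain ⟨ρ, hρ, hc⟩ := hm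
  obtain ⟨τ, hτ, e, he, hτe⟩ := exists_switch (j := j) hs hG hρ (by rw [hc]; exact hi)
  refine ⟨τ, hτ, fun k => ?_⟩
  simp only [hτe, Pi.add_apply, Pi.sub_apply, ← hc]
  by_cases hki : k = i
  · subst hki
    rw [Pi.single_eq_same, Pi.single_eq_of_ne hij, add_zero,
      ← Finset.card_erase_of_mem (a := e) (by simpa using he)]
    congr 1
    ext a
    by_cases ha : a = e <;> simp [ha, hij.symm]
  · rw [Pi.single_eq_of_ne hki, tsub_zero]
    by_cases hkj : k = j
    · subst hkj
      rw [Pi.single_eq_same, ← Finset.card_insert_of_notMem (a := e) (by simpa [he] using hij)]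
      congr 1
      ext a
      by_cases ha : a = e <;> simp [ha]
    · rw [Pi.single_eq_of_ne hkj, add_zero]
      congr 1
      ext a
      by_cases ha : a = e
      · subst ha; simp [he, Ne.symm hkj, Ne.symm hki]
      · simp [ha]

/-- Starting from a monochromatic perfect matching, every profile in which that color stays
frequent can be reached. -/
theorem HasProfile.of_single {G : ColoredBipartite n q} {s : ℕ} (hs : 0 < s)
    (hG : ∀ i, HoleFree (colorRel G i) s) {i : Fin q} (h : HasProfile G (Pi.single i n)) :
    ∀ (N : ℕ) (m : Fin q → ℕ), ∑ k, m k = n → n - m i = N → 3 * s ≤ m i → HasProfile G m := by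
  intro N
  induction N with
  | zero =>
    intro m hm hN _
    have hle : ∀ k, k ≠ i → m k = 0 := fun k hk => by
      have := Finset.add_le_sum (f := m) (s := Finset.univ) (fun _ _ => Nat.zero_le _)
        (Finset.mem_univ k) (Finset.mem_univ i) hk
      omega
    have hi : m i = n := by
      rw [← hm, Finset.sum_eq_single i (fun k _ hk => hle k hk) (by simp)]
    convert h
    ext k
    by_cases hk : k = i
    · subst hk; simp [hi]
    · rw [hle k hk, Pi.single_eq_of_ne hk]
  | succ N ih =>
    intro m hm hN hi
    obtain ⟨j, hj, hmj⟩ : ∃ j, j ≠ i ∧ m j ≠ 0 := by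
      by_contra! hcon
      have : m i = n := by rw [← hm, Finset.sum_eq_single i (fun k _ hk => hcon k hk) (by simp)]
      omega
    -- One switch undone: `m'` is closer to the monochromatic profile, and `m j ≠ 0` keeps the
    -- subtraction honest.
    let m' : Fin q → ℕ := m + Pi.single i 1 - Pi.single j 1
    have hmm' : m' + Pi.single j 1 = m + Pi.single i 1 := by
      refine tsub_add_cancel_of_le fun k => ?_
      by_cases hk : k = j
      · subst hk; simp; omega
      · simp [Pi.single_eq_of_ne hk]
    have hm'i : m' i = m i + 1 := by simp [m', Pi.single_eq_of_ne hj.symm]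
    have hsum : ∑ k, m' k = n := by
      have := congrArg (fun f : Fin q → ℕ => ∑ k, f k) hmm'
      simp only [Pi.add_apply, Finset.sum_add_distrib, Finset.sum_pi_single', Finset.mem_univ,
        if_true, hm] at this
      simpa using this
    have := (ih m' hsum (by omega) (by omega)).switch hs hG hj.symm (by omega)
    convert this using 1
    ext k
    have h1 := congrFun hmm' k
    simp only [Pi.add_apply, Pi.sub_apply] at h1 ⊢
    by_cases hki : k = i
    · subst hki
      rw [Pi.single_eq_same] at h1 ⊢
      omega
    · rw [Pi.single_eq_of_ne hki] at h1 ⊢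
      omega

theorem HasProfile.mem_mcp {G : ColoredBipartite n q} {m : Fin q → ℕ} (h : HasProfile G m) :
    m ∈ mcp G := by
  obtain ⟨ρ, hρ, hc⟩ := h
  have hinj : Function.Injective fun a => (a, ρ a) := fun a b h => congrArg Prod.fst h
  refine ⟨Finset.univ.map ⟨_, hinj⟩, ⟨by simpa using hρ, fun a => ⟨ρ a, by simp, by simp⟩,
    fun b => ⟨ρ.symm b, by simp, fun a ha => ?_⟩⟩, fun i => ?_⟩
  · simp only [Finset.mem_map, Finset.mem_univ, true_and, Function.Embedding.coeFn_mk,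
      Prod.mk.injEq] at ha
    obtain ⟨x, rfl, rfl⟩ := ha
    simp
  · rw [Finset.filter_map, Finset.card_map, ← hc i]
    rfl

theorem IsPerfectMatching.exists_perm {E : Set (Fin n × Fin n)} {M : Finset (Fin n × Fin n)}
    (h : IsPerfectMatching E M) :
    ∃ ρ : Equiv.Perm (Fin n), (∀ a, (a, ρ a) ∈ E) ∧ ∀ e, e ∈ M ↔ ρ e.1 = e.2 := by
  choose f hf hf' using h.2.1
  have hinj : Function.Injective f := fun a a' haa' =>
    (h.2.2 (f a)).unique (hf a) (haa' ▸ hf a')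
  refine ⟨Equiv.ofBijective f (Finite.injective_iff_bijective.1 hinj), fun a => h.1 _ (hf a),
    fun e => ⟨fun he => (hf' e.1 e.2 he).symm, fun he => ?_⟩⟩
  obtain ⟨a, b⟩ := e
  rw [show b = f a from he.symm]
  exact hf a

theorem hasProfile_of_mem_mcp {G : ColoredBipartite n q} {m : Fin q → ℕ} (h : m ∈ mcp G) :
    HasProfile G m := by
  obtain ⟨M, hM, hc⟩ := h
  obtain ⟨ρ, hρ, hMρ⟩ := hM.exists_perm
  refine ⟨ρ, hρ, fun k => ?_⟩
  rw [← hc k]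
  refine Finset.card_bij (fun a _ => (a, ρ a)) (fun a ha => ?_) (fun a _ b _ h => ?_) fun e he => ?_
  · simp only [Finset.mem_filter, Finset.mem_univ, true_and] at ha ⊢
    exact ⟨(hMρ _).2 rfl, ha⟩
  · exact congrArg Prod.fst h
  · obtain ⟨a, b⟩ := e
    simp only [Finset.mem_filter, hMρ] at he
    obtain ⟨rfl, he⟩ := he
    exact ⟨a, by simpa using he, rfl⟩

theorem HasProfile.sum_eq {G : ColoredBipartite n q} {m : Fin q → ℕ} (h : HasProfile G m) :
    ∑ i, m i = n := by
  obtain ⟨ρ, -, hc⟩ := h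
  simp_rw [← hc]
  rw [← Finset.card_eq_sum_card_fiberwise (fun _ _ => Finset.mem_coe.2 (Finset.mem_univ _))]
  simp

/-- Hole-freeness together with monochromatic perfect matchings in all colors gives the full
profile. -/
theorem mem_fullProfile {G : ColoredBipartite n q} {s : ℕ} (hs : 0 < s) (hsn : 3 * s * q < n + q)
    (hG : ∀ i, HoleFree (colorRel G i) s)
    (hM : ∀ i, ∃ ρ : Equiv.Perm (Fin n), ∀ a, colorRel G i a (ρ a)) : G ∈ fullProfile n q := by
  ext m
  refine ⟨fun h => (hasProfile_of_mem_mcp h).sum_eq, fun h => ?_⟩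
  obtain ⟨i, hi⟩ : ∃ i, 3 * s ≤ m i := by
    -- If every `m i + 1` were at most `3 * s`, summing would give `n + q ≤ 3 * s * q`.
    by_contra! hcon
    have h1 : ∑ i, (m i + 1) ≤ ∑ _i : Fin q, 3 * s := Finset.sum_le_sum fun i _ => hcon i
    rw [Finset.sum_add_distrib, show ∑ i, m i = n from h] at h1
    simp only [Finset.sum_const, Finset.card_univ, Fintype.card_fin, smul_eq_mul, mul_one] at h1
    nlinarith
  refine (HasProfile.of_single hs hG (i := i) ?_ _ m h rfl hi).mem_mcp
  obtain ⟨ρ, hρ⟩ := hM i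
  refine ⟨ρ, fun a => (hρ a).1, fun k => ?_⟩
  simp_rw [fun a => (hρ a).2]
  by_cases hk : k = i
  · subst hk; simp
  · simp [hk, Ne.symm hk]

theorem exists_monochromatic_of_mem_fullProfile {G : ColoredBipartite n q}
    (h : G ∈ fullProfile n q) (i : Fin q) :
    ∃ ρ : Equiv.Perm (Fin n), ∀ a, colorRel G i a (ρ a) := by
  have : Pi.single i n ∈ mcp G := by
    rw [show mcp G = _ from h]; simp
  obtain ⟨ρ, hρ, hc⟩ := hasProfile_of_mem_mcp this
  refine ⟨ρ, fun a => ⟨hρ a, ?_⟩⟩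
  have := hc i
  rw [Pi.single_eq_same] at this
  have := (Finset.card_eq_iff_eq_univ _).1 (this.trans (Fintype.card_fin n).symm)
  simpa using this.symm.subset (Finset.mem_univ a)

end Switching

/-! ### Minimal obstructions to Hall's condition -/

section Hall

variable {n : ℕ}

/-- A minimal obstruction to Hall's condition: `S` has one vertex more than `T`, no edge leaves `S`
outside `T`, and every vertex of `T` has two neighbors in `S`. -/
def IsObstruction (R : Fin n → Fin n → Prop) (S T : Finset (Fin n)) : Prop :=
  (∀ a ∈ S, ∀ b ∉ T, ¬ R a b) ∧
    ∀ t ∈ T, ∃ u ∈ S, ∃ v ∈ S, u ≠ v ∧ R u t ∧ R v t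

-- In a Hall violator of least size, deleting a vertex loses no neighbor, as otherwise the rest
-- would still be a violator. Hence every neighbor is seen twice, and the deficiency is one, since a
-- larger one would survive a deletion.
open Classical in
theorem exists_obstruction_of_card_lt {R : Fin n → Fin n → Prop} {S : Finset (Fin n)}
    (hS : (Finset.univ.filter fun b => ∃ a ∈ S, R a b).card < S.card) :
    ∃ j, j < S.card ∧ ∃ S' T : Finset (Fin n), S'.card = j + 1 ∧ T.card = j ∧
      IsObstruction R S' T := by
  let N : Finset (Fin n) → Finset (Fin n) := fun S => Finset.univ.filter fun b => ∃ a ∈ S, R a b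
  obtain ⟨S', hS', hmin⟩ := Finset.exists_min_image
    (Finset.univ.filter fun S => (N S).card < S.card) Finset.card ⟨S, by simpa [N] using hS⟩
  have hle : S'.card ≤ S.card := hmin S (by simpa [N] using hS)
  simp only [Finset.mem_filter, Finset.mem_univ, true_and] at hS' hmin
  have herase : ∀ a ∈ S', N (S'.erase a) = N S' := by
    intro a ha
    refine Finset.eq_of_subset_of_card_le (fun b hb => ?_) ?_
    · simp only [N, Finset.mem_filter, Finset.mem_univ, true_and] at hb ⊢
      obtain ⟨c, hc, hcb⟩ := hb
      exact ⟨c, Finset.mem_of_mem_erase hc, hcb⟩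
    · by_contra! hcon
      have := hmin (S'.erase a) (by rw [Finset.card_erase_of_mem ha]; omega)
      rw [Finset.card_erase_of_mem ha] at this
      omega
  have hcard : S'.card = (N S').card + 1 := by
    obtain ⟨a, ha⟩ : S'.Nonempty := by rw [← Finset.card_pos]; omega
    by_contra hne
    have := hmin (S'.erase a) (by rw [herase a ha, Finset.card_erase_of_mem ha]; omega)
    rw [Finset.card_erase_of_mem ha] at this
    omega
  refine ⟨(N S').card, by omega, S', N S', hcard, rfl, fun a ha b hb hab => hb ?_, fun t ht => ?_⟩
  · simpa [N] using ⟨a, ha, hab⟩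
  · obtain ⟨u, hu, hut⟩ : ∃ u ∈ S', R u t := by simpa [N] using ht
    obtain ⟨v, hv, hvt⟩ : ∃ v ∈ S'.erase u, R v t := by
      have ht' := (herase u hu).symm ▸ ht
      simpa only [N, Finset.mem_filter, Finset.mem_univ, true_and] using ht'
    exact ⟨u, hu, v, Finset.mem_of_mem_erase hv, (Finset.ne_of_mem_erase hv).symm, hut, hvt⟩

/-- In a hole-free relation without a perfect matching, one of the two sides carries a small
obstruction. -/
theorem exists_obstruction {R : Fin n → Fin n → Prop} {s : ℕ} (hR : HoleFree R s)
    (hM : ¬ ∃ ρ : Equiv.Perm (Fin n), ∀ a, R a (ρ a)) :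
    ∃ j, j + 1 < s ∧ ∃ S T : Finset (Fin n), S.card = j + 1 ∧ T.card = j ∧
      (IsObstruction R S T ∨ IsObstruction (fun a b => R b a) S T) := by
  classical
  have hHall : ¬ ∀ A : Finset (Fin n),
      A.card ≤ (Finset.univ.filter fun b => ∃ a ∈ A, R a b).card := by
    intro h
    obtain ⟨f, hf, hfR⟩ := (Fintype.all_card_le_filter_rel_iff_exists_injective R).1
      fun A => by convert h A
    exact hM ⟨Equiv.ofBijective f (Finite.injective_iff_bijective.1 hf), hfR⟩
  push Not at hHall
  obtain ⟨S, hS⟩ := hHall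
  by_cases hSs : S.card < s
  · obtain ⟨j, hj, S', T, hS', hT, h⟩ := exists_obstruction_of_card_lt hS
    by_cases hjs : j + 1 < s
    · exact ⟨j, hjs, S', T, hS', hT, Or.inl h⟩
    · omega
  -- A large violator `S` is traded for the set `D` of its non-neighbors: hole-freeness makes `D`
  -- small, and its neighbors lie in `Sᶜ`, so `D` violates Hall from the other side.
  · let D : Finset (Fin n) := Finset.univ.filter fun b => ¬ ∃ a ∈ S, R a b
    have hDcard : (Finset.univ.filter fun b => ∃ a ∈ S, R a b).card + D.card = n := by
      rw [Finset.card_filter_add_card_filter_not]; simp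
    have hDs : D.card < s := by
      by_contra! hcon
      obtain ⟨a, ha, b, hb, hab⟩ := hR S D (by omega) hcon
      exact (Finset.mem_filter.1 hb).2 ⟨a, ha, hab⟩
    have hND : (Finset.univ.filter fun a => ∃ b ∈ D, R a b) ⊆ Sᶜ := by
      intro a ha
      simp only [D, Finset.mem_filter, Finset.mem_univ, true_and, Finset.mem_compl] at ha ⊢
      obtain ⟨b, hb, hab⟩ := ha
      exact fun haS => hb ⟨a, haS, hab⟩
    have h1 := Finset.card_le_card hND
    rw [Finset.card_compl, Fintype.card_fin] at h1
    have h2 : S.card ≤ n := by simpa using Finset.card_le_univ S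
    obtain ⟨j, hj, S', T, hS', hT, h⟩ := exists_obstruction_of_card_lt
      (R := fun a b => R b a) (S := D) (by omega)
    exact ⟨j, by omega, S', T, hS', hT, Or.inr h⟩

end Hall

/-! ### The law of a single color class -/

section Law

/-- The law of a proposition that holds with probability `r`. -/
noncomputable def propLaw (r : ℝ) : Measure Prop :=
  ENNReal.ofReal r • Measure.dirac True + ENNReal.ofReal (1 - r) • Measure.dirac False

theorem isProbabilityMeasure_propLaw {r : ℝ} (h0 : 0 ≤ r) (h1 : r ≤ 1) :
    IsProbabilityMeasure (propLaw r) := by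
  constructor
  simp only [propLaw, Measure.add_apply, Measure.smul_apply, measure_univ, smul_eq_mul, mul_one]
  rw [← ENNReal.ofReal_add h0 (by linarith)]
  simp

theorem isProbabilityMeasure_colorLaw {q : ℕ} {α : Fin q → ℝ} (hα : ∀ i, 0 < α i)
    (hsum : ∑ i, α i = 1) : IsProbabilityMeasure (colorLaw α) := by
  constructor
  simp only [colorLaw, Measure.finsetSum_apply, Measure.smul_apply, measure_univ, smul_eq_mul,
    mul_one]
  rw [← ENNReal.ofReal_sum_of_nonneg fun i _ => (hα i).le, hsum, ENNReal.ofReal_one]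

theorem isProbabilityMeasure_coloredGnnp {n q : ℕ} {α : Fin q → ℝ} (hα : ∀ i, 0 < α i)
    (hsum : ∑ i, α i = 1) (p : I) : IsProbabilityMeasure (coloredGnnp n p α) := by
  have := isProbabilityMeasure_colorLaw hα hsum
  unfold coloredGnnp
  infer_instance

theorem colorLaw_singleton {q : ℕ} (α : Fin q → ℝ) (i : Fin q) :
    colorLaw α {i} = ENNReal.ofReal (α i) := by
  simp [colorLaw, Measure.finsetSum_apply, Set.indicator_apply]

theorem setBernoulli_mem_measurePreserving {ι : Type*} [Fintype ι] (p : I) :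
    MeasurePreserving (fun (E : Set ι) (e : ι) => e ∈ E) (setBernoulli Set.univ p)
      (Measure.pi fun _ : ι => propLaw p) := by
  have hp : (propLaw p : Measure Prop) = unitInterval.toNNReal p • Measure.dirac True +
      unitInterval.toNNReal (unitInterval.symm p) • Measure.dirac False := by
    have h : ∀ x : I, (unitInterval.toNNReal x : ℝ≥0∞) = ENNReal.ofReal x := fun x => by
      rw [← unitInterval.coe_toNNReal, ENNReal.ofReal_coe_nnreal]
    ext s -
    simp only [propLaw, Measure.add_apply, Measure.smul_apply, smul_eq_mul, ENNReal.smul_def, h,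
      unitInterval.coe_symm_eq]
  refine ⟨MeasurableEquiv.setOfPred.symm.measurable, ?_⟩
  rw [setBernoulli_eq_map, ← Measure.infinitePi_eq_pi (hμ := fun _ =>
    isProbabilityMeasure_propLaw p.2.1 p.2.2), Measure.map_map]
  · simp only [Set.mem_univ, ← hp]
    exact Measure.map_id
  · exact MeasurableEquiv.setOfPred.symm.measurable
  · exact MeasurableEquiv.setOfPred.measurable

/-- Whether the individual pairs are edges of color `i` are independent events of probability
`p * α i`. -/
theorem measurePreserving_colorClass {n q : ℕ} {α : Fin q → ℝ} (hα : ∀ i, 0 < α i)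
    (hsum : ∑ i, α i = 1) (p : I) (i : Fin q) :
    MeasurePreserving (fun (G : ColoredBipartite n q) e => e ∈ G.1 ∧ G.2 e = i)
      (coloredGnnp n p α) (Measure.pi fun _ : Fin n × Fin n => propLaw (p * α i)) := by
  have := isProbabilityMeasure_colorLaw hα hsum
  have := isProbabilityMeasure_propLaw p.2.1 p.2.2
  have hα1 : α i ≤ 1 := hsum ▸ Finset.single_le_sum (fun j _ => (hα j).le) (Finset.mem_univ i)
  have := isProbabilityMeasure_propLaw (mul_nonneg p.2.1 (hα i).le)
    (mul_le_one₀ p.2.2 (hα i).le hα1)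
  have hone : ((propLaw p).prod (colorLaw α)).map (fun x => x.1 ∧ x.2 = i) =
      propLaw (p * α i) := by
    have hmeas : Measurable fun x : Prop × Fin q => (x.1 ∧ x.2 = i) := Measurable.of_discrete
    have hprob := Measure.isProbabilityMeasure_map (μ := (propLaw p).prod (colorLaw α))
      hmeas.aemeasurable
    have hT : ((propLaw p).prod (colorLaw α)).map (fun x => x.1 ∧ x.2 = i) {True} =
        propLaw (p * α i) {True} := by
      rw [Measure.map_apply hmeas .of_discrete]
      have : (fun x : Prop × Fin q => (x.1 ∧ x.2 = i)) ⁻¹' {True} = {True} ×ˢ {i} := by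
        ext ⟨x, c⟩; simp
      rw [this, Measure.prod_prod, colorLaw_singleton]
      simp [propLaw, ENNReal.ofReal_mul p.2.1]
    have hc : ({False} : Set Prop) = {True}ᶜ := by
      ext x; by_cases x <;> simp [*]
    refine Measure.ext_of_singleton fun x => ?_
    by_cases hx : x
    · simpa only [hx] using hT
    · simp only [hx]
      rw [hc, prob_compl_eq_one_sub .of_discrete, prob_compl_eq_one_sub .of_discrete, hT]
  -- The edge and color families are regrouped into independent (presence, color) pairs, to which
  -- the one-pair computation `hone` applies coordinatewise.
  have h1 := (setBernoulli_mem_measurePreserving (ι := Fin n × Fin n) p).prod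
    (MeasurePreserving.id (Measure.pi fun _ : Fin n × Fin n => colorLaw α))
  have h2 := (measurePreserving_arrowProdEquivProdArrow Prop (Fin q) (Fin n × Fin n)
    (fun _ => propLaw p) (fun _ => colorLaw α)).symm
  have h3 : MeasurePreserving (fun (x : Fin n × Fin n → Prop × Fin q) e => (x e).1 ∧ (x e).2 = i)
      (Measure.pi fun _ => (propLaw p).prod (colorLaw α))
      (Measure.pi fun _ : Fin n × Fin n => propLaw (p * α i)) := by
    refine ⟨Measurable.of_discrete, ?_⟩
    have := Measure.pi_map_pi (μ := fun _ : Fin n × Fin n => (propLaw p).prod (colorLaw α))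
      (f := fun _ x => (x.1 ∧ x.2 = i)) (hμ := fun _ => by rw [hone]; infer_instance)
      fun _ => Measurable.of_discrete.aemeasurable
    rw [this]
    simp only [hone]
  exact h3.comp (h2.comp h1)

variable {n q : ℕ} {α : Fin q → ℝ}

/-- The probability that prescribed pairs are edges of color `i` and others are not. -/
theorem coloredGnnp_real_box (hα : ∀ i, 0 < α i) (hsum : ∑ i, α i = 1) (p : I) (i : Fin q)
    {F₁ F₂ : Finset (Fin n × Fin n)} (hF : Disjoint F₁ F₂) :
    (coloredGnnp n p α).real {G | (∀ e ∈ F₁, colorRel G i e.1 e.2) ∧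
      ∀ e ∈ F₂, ¬ colorRel G i e.1 e.2} = (p * α i) ^ F₁.card * (1 - p * α i) ^ F₂.card := by
  have hα1 : α i ≤ 1 := hsum ▸ Finset.single_le_sum (fun j _ => (hα j).le) (Finset.mem_univ i)
  have h0 := mul_nonneg p.2.1 (hα i).le
  have h1 := mul_le_one₀ p.2.2 (hα i).le hα1
  have := isProbabilityMeasure_propLaw h0 h1
  classical
  have hset : {G : ColoredBipartite n q | (∀ e ∈ F₁, colorRel G i e.1 e.2) ∧
      ∀ e ∈ F₂, ¬ colorRel G i e.1 e.2} =
      (fun (G : ColoredBipartite n q) e => e ∈ G.1 ∧ G.2 e = i) ⁻¹'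
        Set.univ.pi (fun e => if e ∈ F₁ then {True} else if e ∈ F₂ then {False} else Set.univ) := by
    ext G
    simp only [colorRel, Set.mem_ofPred_eq, Set.mem_preimage, Set.mem_univ_pi]
    constructor
    · intro h e
      split_ifs with h1 h2
      · simpa using h.1 e h1
      · simpa using h.2 e h2
      · trivial
    · intro h
      refine ⟨fun e he => ?_, fun e he => ?_⟩
      · simpa [he] using h e
      · simpa [he, Finset.disjoint_right.1 hF he] using h e
  rw [hset, measureReal_def, (measurePreserving_colorClass hα hsum p i).measure_preimage
    MeasurableSet.of_discrete.nullMeasurableSet, Measure.pi_pi]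
  have hprod : ∀ e : Fin n × Fin n, propLaw (p * α i)
      (if e ∈ F₁ then {True} else if e ∈ F₂ then {False} else Set.univ) =
      (if e ∈ F₁ then ENNReal.ofReal (p * α i) else 1) *
        (if e ∈ F₂ then ENNReal.ofReal (1 - p * α i) else 1) := by
    intro e
    by_cases he1 : e ∈ F₁
    · simp [he1, Finset.disjoint_left.1 hF he1, propLaw]
    · by_cases he2 : e ∈ F₂
      · simp [he1, he2, propLaw]
      · simp [he1, he2]
  simp_rw [hprod]
  rw [Finset.prod_mul_distrib, Finset.prod_ite_mem, Finset.prod_ite_mem]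
  simp [h0, sub_nonneg.2 h1]

/-- The probability that no vertex of the first class is isolated in color `i`. -/
theorem coloredGnnp_real_forall_exists (hα : ∀ i, 0 < α i) (hsum : ∑ i, α i = 1) (p : I)
    (i : Fin q) :
    (coloredGnnp n p α).real {G | ∀ a, ∃ b, colorRel G i a b} =
      (1 - (1 - p * α i) ^ n) ^ n := by
  have hα1 : α i ≤ 1 := hsum ▸ Finset.single_le_sum (fun j _ => (hα j).le) (Finset.mem_univ i)
  have h0 := mul_nonneg p.2.1 (hα i).le
  have h1 := mul_le_one₀ p.2.2 (hα i).le hα1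
  have := isProbabilityMeasure_propLaw h0 h1
  -- Currying splits the pairs into independent rows, each of which must avoid the all-`False`
  -- value.
  have hset : {G : ColoredBipartite n q | ∀ a, ∃ b, colorRel G i a b} =
      (fun (G : ColoredBipartite n q) e => e ∈ G.1 ∧ G.2 e = i) ⁻¹'
        (MeasurableEquiv.curry (Fin n) (Fin n) Prop ⁻¹'
          Set.univ.pi fun _ => (Set.univ.pi fun _ => {False})ᶜ) := by
    ext G
    simp [colorRel, MeasurableEquiv.curry, Set.mem_pi]
  have hcurry := Measure.infinitePi_map_curry
    (fun (_ : Fin n) (_ : Fin n) => propLaw (p * α i))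
  simp_rw [Measure.infinitePi_eq_pi] at hcurry
  rw [hset, measureReal_def, (measurePreserving_colorClass hα hsum p i).measure_preimage
    MeasurableSet.of_discrete.nullMeasurableSet,
    ← MeasurableEquiv.map_apply, hcurry, Measure.pi_pi]
  simp_rw [prob_compl_eq_one_sub (MeasurableSet.of_discrete), Measure.pi_pi]
  have hF : propLaw (p * α i) {False} = ENNReal.ofReal (1 - p * α i) := by simp [propLaw]
  simp only [hF, Finset.prod_const, Finset.card_univ, Fintype.card_fin, ENNReal.toReal_pow]
  rw [ENNReal.toReal_sub_of_le (pow_le_one' (by simp [h0]) n) ENNReal.one_ne_top,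
    ENNReal.toReal_pow, ENNReal.toReal_ofReal (sub_nonneg.2 h1), ENNReal.toReal_one]

end Law

/-! ### First-moment bounds for holes and obstructions -/

section UnionBounds

variable {n : ℕ} {Ω : Type*} [MeasurableSpace Ω] {μ : Measure Ω}

/-- The random relation `X` satisfies the upper bounds, for prescribed pairs in and out of the
relation, of a relation whose pairs are present independently with probability `r`. -/
def BoxBound (μ : Measure Ω) (X : Ω → Fin n → Fin n → Prop) (r : ℝ) : Prop :=
  ∀ F₁ F₂ : Finset (Fin n × Fin n), Disjoint F₁ F₂ →
    μ.real {ω | (∀ e ∈ F₁, X ω e.1 e.2) ∧ ∀ e ∈ F₂, ¬ X ω e.1 e.2} ≤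
      r ^ F₁.card * (1 - r) ^ F₂.card

/-- Gives obstructions on the second side the same bound as those on the first. -/
theorem BoxBound.flip {X : Ω → Fin n → Fin n → Prop} {r : ℝ} (h : BoxBound μ X r) :
    BoxBound μ (fun ω a b => X ω b a) r := by
  intro F₁ F₂ hF
  have := h (F₁.map (Equiv.prodComm _ _).toEmbedding) (F₂.map (Equiv.prodComm _ _).toEmbedding)
    ((Finset.disjoint_map _).2 hF)
  rw [Finset.card_map, Finset.card_map] at this
  simp only [Finset.forall_mem_map] at this
  exact this

variable [IsProbabilityMeasure μ]

theorem BoxBound.not_holeFree_le {X : Ω → Fin n → Fin n → Prop} {r : ℝ} (h : BoxBound μ X r)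
    (h0 : 0 ≤ r) (h1 : r ≤ 1) (s : ℕ) :
    μ.real {ω | ¬ HoleFree (X ω) s} ≤ 4 ^ n * (1 - r) ^ (s * s) := by
  classical
  let P : Finset (Finset (Fin n) × Finset (Fin n)) :=
    Finset.univ.filter fun x => s ≤ x.1.card ∧ s ≤ x.2.card
  have hsub : {ω | ¬ HoleFree (X ω) s} ⊆
      ⋃ x ∈ P, {ω | (∀ e ∈ (∅ : Finset (Fin n × Fin n)), X ω e.1 e.2) ∧
        ∀ e ∈ x.1 ×ˢ x.2, ¬ X ω e.1 e.2} := by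
    intro ω hω
    simp only [HoleFree, Set.mem_ofPred_eq] at hω
    push Not at hω
    obtain ⟨S, T, hS, hT, hST⟩ := hω
    refine Set.mem_biUnion (x := (S, T)) (by simp [P, hS, hT]) ⟨by simp, fun e he => ?_⟩
    rw [Finset.mem_product] at he
    exact hST e.1 he.1 e.2 he.2
  refine (measureReal_mono hsub (measure_ne_top _ _)).trans
    ((measureReal_biUnion_finset_le _ _).trans ?_)
  have hle : ∀ x ∈ P, μ.real {ω | (∀ e ∈ (∅ : Finset (Fin n × Fin n)), X ω e.1 e.2) ∧
        ∀ e ∈ x.1 ×ˢ x.2, ¬ X ω e.1 e.2} ≤ (1 - r) ^ (s * s) := by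
    intro x hx
    refine (h ∅ (x.1 ×ˢ x.2) (by simp)).trans ?_
    simp only [P, Finset.mem_filter, Finset.mem_univ, true_and] at hx
    rw [Finset.card_empty, pow_zero, one_mul, Finset.card_product]
    exact pow_le_pow_of_le_one (by linarith) (by linarith) (Nat.mul_le_mul hx.1 hx.2)
  refine (Finset.sum_le_card_nsmul _ _ _ hle).trans ?_
  rw [nsmul_eq_mul]
  refine mul_le_mul_of_nonneg_right ?_ (pow_nonneg (by linarith) _)
  have hP : P.card ≤ 4 ^ n := by
    refine (Finset.card_le_univ P).trans ?_
    rw [Fintype.card_prod, Fintype.card_finset, Fintype.card_fin, ← mul_pow]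
    norm_num
  exact_mod_cast hP

/-- A union bound over the choice of two distinct neighbors in `S` for each vertex of `T`: this
prescribes `2 * j` edges, disjoint from the absent pairs `S ×ˢ Tᶜ`. -/
theorem BoxBound.isObstruction_le {X : Ω → Fin n → Fin n → Prop} {r : ℝ} (h : BoxBound μ X r)
    (h0 : 0 ≤ r) (h1 : r ≤ 1) {j : ℕ} {S T : Finset (Fin n)} (hS : S.card = j + 1)
    (hT : T.card = j) :
    μ.real {ω | IsObstruction (X ω) S T} ≤
      ((j + 1 : ℝ) ^ 2) ^ j * (r ^ (2 * j) * (1 - r) ^ ((j + 1) * (n - j))) := by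
  classical
  -- Off `T` the choice is pinned to a dummy value, so only the `j` vertices of `T` are counted.
  let P : Finset (Fin n → Fin n × Fin n) :=
    Fintype.piFinset fun t => if t ∈ T then S.offDiag else {(t, t)}
  let F₁ : (Fin n → Fin n × Fin n) → Finset (Fin n × Fin n) := fun g =>
    T.image (fun t => ((g t).1, t)) ∪ T.image (fun t => ((g t).2, t))
  have hsub : {ω | IsObstruction (X ω) S T} ⊆
      ⋃ g ∈ P, {ω | (∀ e ∈ F₁ g, X ω e.1 e.2) ∧ ∀ e ∈ S ×ˢ Tᶜ, ¬ X ω e.1 e.2} := by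
    intro ω hω
    have hg : ∀ t, ∃ x : Fin n × Fin n, x ∈ (if t ∈ T then S.offDiag else {(t, t)}) ∧
        (t ∈ T → X ω x.1 t ∧ X ω x.2 t) := by
      intro t
      by_cases ht : t ∈ T
      · obtain ⟨u, hu, v, hv, huv, hut, hvt⟩ := hω.2 t ht
        exact ⟨(u, v), by simp [ht, hu, hv, huv], fun _ => ⟨hut, hvt⟩⟩
      · exact ⟨(t, t), by simp [ht], fun h => absurd h ht⟩
    choose g hgP hgX using hg
    refine Set.mem_biUnion (x := g) (Fintype.mem_piFinset.2 hgP) ⟨fun e he => ?_, fun e he => ?_⟩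
    · simp only [F₁, Finset.mem_union, Finset.mem_image] at he
      rcases he with ⟨t, ht, rfl⟩ | ⟨t, ht, rfl⟩
      · exact (hgX t ht).1
      · exact (hgX t ht).2
    · rw [Finset.mem_product, Finset.mem_compl] at he
      exact hω.1 _ he.1 _ he.2
  refine (measureReal_mono hsub (measure_ne_top _ _)).trans
    ((measureReal_biUnion_finset_le _ _).trans ?_)
  have hle : ∀ g ∈ P, μ.real {ω | (∀ e ∈ F₁ g, X ω e.1 e.2) ∧ ∀ e ∈ S ×ˢ Tᶜ, ¬ X ω e.1 e.2} ≤
      r ^ (2 * j) * (1 - r) ^ ((j + 1) * (n - j)) := by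
    intro g hg
    have hdisj : Disjoint (F₁ g) (S ×ˢ Tᶜ) := by
      rw [Finset.disjoint_left]
      intro e he he'
      rw [Finset.mem_product, Finset.mem_compl] at he'
      simp only [F₁, Finset.mem_union, Finset.mem_image] at he
      rcases he with ⟨t, ht, rfl⟩ | ⟨t, ht, rfl⟩ <;> exact he'.2 ht
    have hcard : (F₁ g).card = 2 * j := by
      rw [Finset.card_union_of_disjoint, Finset.card_image_of_injective,
        Finset.card_image_of_injective, hT, two_mul]
      · exact fun a b hab => congrArg Prod.snd hab
      · exact fun a b hab => congrArg Prod.snd hab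
      · rw [Finset.disjoint_left]
        intro e he he'
        rw [Finset.mem_image] at he he'
        obtain ⟨t, ht, rfl⟩ := he
        obtain ⟨t', ht', hE⟩ := he'
        obtain rfl : t' = t := congrArg Prod.snd hE
        have hmem := Fintype.mem_piFinset.1 hg t'
        rw [if_pos ht', Finset.mem_offDiag] at hmem
        exact hmem.2.2 (congrArg Prod.fst hE).symm
    refine (h _ _ hdisj).trans_eq ?_
    rw [hcard, Finset.card_product, Finset.card_compl, hS, hT, Fintype.card_fin]
  refine (Finset.sum_le_card_nsmul _ _ _ hle).trans ?_
  rw [nsmul_eq_mul]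
  refine mul_le_mul_of_nonneg_right ?_ (mul_nonneg (pow_nonneg h0 _) (pow_nonneg (by linarith) _))
  have hP : P.card ≤ ((j + 1) ^ 2) ^ j := by
    rw [Fintype.card_piFinset]
    simp_rw [apply_ite Finset.card]
    rw [Finset.prod_ite]
    simp only [Finset.filter_mem_eq_inter, Finset.univ_inter, Finset.prod_const, hT, hS,
      Finset.offDiag_card, Finset.card_singleton, one_pow, mul_one]
    exact Nat.pow_le_pow_left (by rw [sq]; exact Nat.sub_le _ _) j
  exact_mod_cast hP

theorem BoxBound.exists_isObstruction_le {X : Ω → Fin n → Fin n → Prop} {r : ℝ}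
    (h : BoxBound μ X r) (h0 : 0 ≤ r) (h1 : r ≤ 1) (j : ℕ) :
    μ.real {ω | ∃ S T : Finset (Fin n), S.card = j + 1 ∧ T.card = j ∧ IsObstruction (X ω) S T} ≤
      n.choose (j + 1) * n.choose j *
        (((j + 1 : ℝ) ^ 2) ^ j * (r ^ (2 * j) * (1 - r) ^ ((j + 1) * (n - j)))) := by
  classical
  let P : Finset (Finset (Fin n) × Finset (Fin n)) :=
    Finset.univ.powersetCard (j + 1) ×ˢ Finset.univ.powersetCard j
  have hsub : {ω | ∃ S T : Finset (Fin n), S.card = j + 1 ∧ T.card = j ∧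
      IsObstruction (X ω) S T} ⊆ ⋃ x ∈ P, {ω | IsObstruction (X ω) x.1 x.2} := by
    rintro ω ⟨S, T, hS, hT, hST⟩
    exact Set.mem_biUnion (x := (S, T)) (by simp [P, hS, hT]) hST
  refine (measureReal_mono hsub (measure_ne_top _ _)).trans
    ((measureReal_biUnion_finset_le _ _).trans ?_)
  refine (Finset.sum_le_card_nsmul _ _ _ fun x hx => h.isObstruction_le h0 h1 (S := x.1) (T := x.2)
    (j := j) ?_ ?_).trans_eq ?_
  · simp only [P, Finset.mem_product, Finset.mem_powersetCard] at hx; exact hx.1.2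
  · simp only [P, Finset.mem_product, Finset.mem_powersetCard] at hx; exact hx.2.2
  · simp [P, nsmul_eq_mul]

theorem choose_le_exp_mul_div_pow (n : ℕ) {j : ℕ} (hj : 0 < j) :
    (n.choose j : ℝ) ≤ (Real.exp 1 * n / j) ^ j := by
  have hj' : (0 : ℝ) < j := by exact_mod_cast hj
  have hfac : (0 : ℝ) < j.factorial := by exact_mod_cast j.factorial_pos
  have h := Real.pow_div_factorial_le_exp (j : ℝ) hj'.le j
  rw [← mul_one (j : ℝ), Real.exp_nat_mul, mul_one] at h
  refine (Nat.choose_le_pow_div j n).trans ?_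
  rw [div_pow, mul_pow, div_le_div_iff₀ hfac (by positivity)]
  rw [div_le_iff₀ hfac] at h
  calc (n : ℝ) ^ j * (j : ℝ) ^ j ≤ (n : ℝ) ^ j * (Real.exp 1 ^ j * j.factorial) := by gcongr
    _ = _ := by ring

theorem choose_succ_le_mul_choose_bound (n : ℕ) {j : ℕ} (hj : 0 < j) :
    (n.choose (j + 1) : ℝ) ≤ n * (Real.exp 1 * n / j) ^ j := by
  have h1 : n.choose (j + 1) ≤ n * n.choose j := by
    have := Nat.choose_succ_right_eq n j
    calc n.choose (j + 1) ≤ n.choose (j + 1) * (j + 1) := Nat.le_mul_of_pos_right _ (by omega)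
      _ = n.choose j * (n - j) := this
      _ ≤ n.choose j * n := Nat.mul_le_mul_left _ (Nat.sub_le _ _)
      _ = _ := mul_comm _ _
  calc (n.choose (j + 1) : ℝ) ≤ n * n.choose j := by exact_mod_cast h1
    _ ≤ _ := by gcongr; exact choose_le_exp_mul_div_pow n hj

theorem one_sub_pow_le_exp {r : ℝ} (h1 : r ≤ 1) (m : ℕ) :
    (1 - r) ^ m ≤ Real.exp (-(r * m)) := by
  calc (1 - r) ^ m ≤ Real.exp (-r) ^ m :=
        pow_le_pow_left₀ (by linarith) (Real.one_sub_le_exp_neg r) m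
    _ = _ := by rw [← Real.exp_nat_mul]; ring_nf

/-- The powers of `j` from the binomials and from the neighbor choices cancel. The spare factor `n`
is paid for by `exp (n * r)`, and `n - j ≥ 3 * n / 4` leaves enough decay. -/
theorem obstruction_bound_le {r : ℝ} (h0 : 0 ≤ r) (h1 : r ≤ 1) {j : ℕ} (hj : 0 < j)
    (hjn : 4 * j ≤ n) (hn : (n : ℝ) ≤ Real.exp (n * r)) :
    n.choose (j + 1) * n.choose j *
        (((j + 1 : ℝ) ^ 2) ^ j * (r ^ (2 * j) * (1 - r) ^ ((j + 1) * (n - j)))) ≤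
      ((2 * Real.exp 1 * (n * r)) ^ 2 * Real.exp (-(n * r) / 2)) ^ j := by
  have hj' : (1 : ℝ) ≤ j := by exact_mod_cast hj
  have hjn' : 4 * (j : ℝ) ≤ n := by exact_mod_cast hjn
  have hx : 0 ≤ (n : ℝ) * r := by positivity
  have hexp : (1 - r) ^ ((j + 1) * (n - j)) ≤ Real.exp (-(3 / 4 * (n * r) * (j + 1))) := by
    refine (one_sub_pow_le_exp h1 _).trans (Real.exp_le_exp.2 (neg_le_neg ?_))
    rw [Nat.cast_mul, Nat.cast_sub (by omega)]
    push_cast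
    have : 3 / 4 * (n : ℝ) ≤ n - j := by linarith
    calc 3 / 4 * (n * r) * (j + 1) = r * ((j + 1) * (3 / 4 * n)) := by ring
      _ ≤ _ := by gcongr
  have hsq : (j + 1 : ℝ) ^ 2 ≤ (2 * j) ^ 2 := by gcongr; linarith
  calc n.choose (j + 1) * n.choose j *
        (((j + 1 : ℝ) ^ 2) ^ j * (r ^ (2 * j) * (1 - r) ^ ((j + 1) * (n - j))))
      ≤ (n * (Real.exp 1 * n / j) ^ j) * (Real.exp 1 * n / j) ^ j *
        (((2 * j : ℝ) ^ 2) ^ j * (r ^ (2 * j) * Real.exp (-(3 / 4 * (n * r) * (j + 1))))) := by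
        have := choose_succ_le_mul_choose_bound n hj
        have := choose_le_exp_mul_div_pow n hj
        have : 0 ≤ (1 - r) ^ ((j + 1) * (n - j)) := pow_nonneg (by linarith) _
        gcongr
    _ = ((Real.exp 1 * n / j * (2 * j) * r) ^ 2) ^ j *
        (n * Real.exp (-(3 / 4 * (n * r) * (j + 1)))) := by ring
    _ = ((2 * Real.exp 1 * (n * r)) ^ 2) ^ j *
        (n * Real.exp (-(3 / 4 * (n * r) * (j + 1)))) := by
        congr 3
        field_simp
    _ ≤ ((2 * Real.exp 1 * (n * r)) ^ 2) ^ j *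
        (Real.exp (n * r) * Real.exp (-(3 / 4 * (n * r) * (j + 1)))) := by gcongr
    _ ≤ ((2 * Real.exp 1 * (n * r)) ^ 2) ^ j * Real.exp (-(n * r) / 2) ^ j := by
        gcongr
        rw [← Real.exp_add, ← Real.exp_nat_mul]
        refine Real.exp_le_exp.2 ?_
        -- This is `1 - 3 * (j + 1) / 4 ≤ -j / 2` times `n * r`, with equality at `j = 1`.
        nlinarith
    _ = _ := by rw [← mul_pow]

/-- The term `j = 0` counts isolated vertices; the others are dominated by a geometric series of
ratio `1 / 2`. -/
theorem sum_obstruction_bound_le {r : ℝ} (h0 : 0 ≤ r) (h1 : r ≤ 1) {N : ℕ} (hN : 4 * N ≤ n)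
    (hn : (n : ℝ) ≤ Real.exp (n * r))
    (hy : (2 * Real.exp 1 * (n * r)) ^ 2 * Real.exp (-(n * r) / 2) ≤ 1 / 2) :
    ∑ j ∈ Finset.range (N + 1), (n.choose (j + 1) * n.choose j *
        (((j + 1 : ℝ) ^ 2) ^ j * (r ^ (2 * j) * (1 - r) ^ ((j + 1) * (n - j))))) ≤
      n * Real.exp (-(n * r)) +
        2 * ((2 * Real.exp 1 * (n * r)) ^ 2 * Real.exp (-(n * r) / 2)) := by
  set y := (2 * Real.exp 1 * (n * r)) ^ 2 * Real.exp (-(n * r) / 2) with hydef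
  have hy0 : 0 ≤ y := by positivity
  rw [Finset.sum_range_succ', add_comm]
  refine add_le_add ?_ ?_
  · have := one_sub_pow_le_exp h1 n
    simp only [zero_add, Nat.choose_one_right, Nat.choose_zero_right, Nat.cast_one, mul_one,
      pow_zero, mul_zero, one_mul, Nat.sub_zero]
    rw [mul_comm (n : ℝ) r]
    gcongr
  · calc _ ≤ ∑ j ∈ Finset.range N, y * (1 / 2) ^ j := by
          refine Finset.sum_le_sum fun j hj => ?_
          rw [Finset.mem_range] at hj
          refine (obstruction_bound_le h0 h1 (Nat.succ_pos j) (by omega) hn).trans ?_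
          rw [← hydef, pow_succ']
          gcongr
      _ = y * ∑ j ∈ Finset.range N, (1 / 2 : ℝ) ^ j := by rw [Finset.mul_sum]
      _ ≤ y * 2 := by gcongr; exact sum_geometric_two_le N
      _ = 2 * y := mul_comm _ _

theorem BoxBound.no_matching_le {X : Ω → Fin n → Fin n → Prop} {r : ℝ} (h : BoxBound μ X r)
    (h0 : 0 ≤ r) (h1 : r ≤ 1) {N : ℕ} (hN : 4 * N ≤ n) (hn : (n : ℝ) ≤ Real.exp (n * r))
    (hy : (2 * Real.exp 1 * (n * r)) ^ 2 * Real.exp (-(n * r) / 2) ≤ 1 / 2) :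
    μ.real {ω | HoleFree (X ω) (N + 1) ∧ ¬ ∃ ρ : Equiv.Perm (Fin n), ∀ a, X ω a (ρ a)} ≤
      2 * (n * Real.exp (-(n * r)) +
        2 * ((2 * Real.exp 1 * (n * r)) ^ 2 * Real.exp (-(n * r) / 2))) := by
  let A : (Ω → Fin n → Fin n → Prop) → ℕ → Set Ω := fun X j =>
    {ω | ∃ S T : Finset (Fin n), S.card = j + 1 ∧ T.card = j ∧ IsObstruction (X ω) S T}
  have hsub : {ω | HoleFree (X ω) (N + 1) ∧ ¬ ∃ ρ : Equiv.Perm (Fin n), ∀ a, X ω a (ρ a)} ⊆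
      (⋃ j ∈ Finset.range (N + 1), A X j) ∪
        ⋃ j ∈ Finset.range (N + 1), A (fun ω a b => X ω b a) j := by
    rintro ω ⟨hfree, hM⟩
    obtain ⟨j, hj, S, T, hS, hT, hO | hO⟩ := exists_obstruction hfree hM
    · exact Or.inl (Set.mem_biUnion (x := j) (by simp; omega) ⟨S, T, hS, hT, hO⟩)
    · exact Or.inr (Set.mem_biUnion (x := j) (by simp; omega) ⟨S, T, hS, hT, hO⟩)
  have hA : ∀ X : Ω → Fin n → Fin n → Prop, BoxBound μ X r →
      μ.real (⋃ j ∈ Finset.range (N + 1), A X j) ≤ n * Real.exp (-(n * r)) +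
        2 * ((2 * Real.exp 1 * (n * r)) ^ 2 * Real.exp (-(n * r) / 2)) := fun X hX =>
    (measureReal_biUnion_finset_le _ _).trans <|
      (Finset.sum_le_sum fun j _ => hX.exists_isObstruction_le h0 h1 j).trans <|
        sum_obstruction_bound_le h0 h1 hN hn hy
  refine (measureReal_mono hsub (measure_ne_top _ _)).trans ((measureReal_union_le _ _).trans ?_)
  rw [two_mul]
  exact add_le_add (hA _ h) (hA _ h.flip)

end UnionBounds

/-! ### Limits of the error terms -/

section Asymptotics

theorem tendsto_log_natCast_atTop : Tendsto (fun n : ℕ => Real.log n) atTop atTop :=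
  Real.tendsto_log_atTop.comp tendsto_natCast_atTop_atTop

theorem tendsto_mul_exp_neg {x : ℕ → ℝ} (hx : Tendsto (fun n : ℕ => x n - Real.log n) atTop atTop) :
    Tendsto (fun n : ℕ => n * Real.exp (-x n)) atTop (𝓝 0) := by
  refine (Real.tendsto_exp_neg_atTop_nhds_zero.comp hx).congr' ?_
  filter_upwards [eventually_gt_atTop 0] with n hn
  have hn' : (0 : ℝ) < n := by exact_mod_cast hn
  simp only [Function.comp_apply]
  rw [neg_sub, sub_eq_add_neg, Real.exp_add, Real.exp_log hn']

theorem tendsto_sq_mul_exp_neg_half {x : ℕ → ℝ} (hx : Tendsto x atTop atTop) :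
    Tendsto (fun n : ℕ => (2 * Real.exp 1 * x n) ^ 2 * Real.exp (-x n / 2)) atTop (𝓝 0) := by
  have h := ((Real.tendsto_pow_mul_exp_neg_atTop_nhds_zero 2).comp
    (hx.atTop_div_const (two_pos))).const_mul ((4 * Real.exp 1) ^ 2)
  rw [mul_zero] at h
  refine h.congr fun n => ?_
  simp only [Function.comp_apply]
  ring_nf

/-- With `s ≥ n / (4 * q)`, the exponent `r * s ^ 2` is at least `n * (n * r) / (16 * q ^ 2)`, which
beats `n * log 4` once `n * r → ∞`. -/
theorem tendsto_hole_bound {q : ℕ} (hq : 0 < q) {r : ℕ → ℝ} (h0 : ∀ n, 0 ≤ r n)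
    (h1 : ∀ n, r n ≤ 1) (hr : Tendsto (fun n : ℕ => n * r n) atTop atTop) :
    Tendsto (fun n : ℕ => (4 : ℝ) ^ n * (1 - r n) ^ ((n / (4 * q) + 1) * (n / (4 * q) + 1)))
      atTop (𝓝 0) := by
  have hlim : Tendsto (fun n : ℕ => Real.exp (-(n : ℝ))) atTop (𝓝 0) :=
    Real.tendsto_exp_neg_atTop_nhds_zero.comp tendsto_natCast_atTop_atTop
  refine squeeze_zero' (Eventually.of_forall fun n => mul_nonneg (by positivity)
    (pow_nonneg (by linarith [h1 n]) _)) ?_ hlim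
  filter_upwards [hr.eventually_ge_atTop ((Real.log 4 + 1) * (16 * q ^ 2))] with n hn
  have hq' : (0 : ℝ) < q := by exact_mod_cast hq
  have hs : (n : ℝ) / (4 * q) ≤ (n / (4 * q) + 1 : ℕ) := by
    rw [div_le_iff₀ (by positivity)]
    have := (Nat.lt_mul_div_succ n (show 0 < 4 * q by omega)).le
    calc (n : ℝ) ≤ ((4 * q * (n / (4 * q) + 1) : ℕ) : ℝ) := by exact_mod_cast this
      _ = _ := by push_cast; ring
  calc (4 : ℝ) ^ n * (1 - r n) ^ ((n / (4 * q) + 1) * (n / (4 * q) + 1))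
      ≤ Real.exp (n * Real.log 4) *
        Real.exp (-(r n * (((n / (4 * q) + 1) * (n / (4 * q) + 1) : ℕ)))) := by
        rw [Real.exp_nat_mul, Real.exp_log (by norm_num)]
        exact mul_le_mul_of_nonneg_left (one_sub_pow_le_exp (h1 n) _) (by positivity)
    _ ≤ Real.exp (n * Real.log 4) * Real.exp (-(n * (Real.log 4 + 1))) := by
        refine mul_le_mul_of_nonneg_left (Real.exp_le_exp.2 (neg_le_neg ?_)) (Real.exp_pos _).le
        rw [Nat.cast_mul]
        calc n * (Real.log 4 + 1) = n * ((Real.log 4 + 1) * (16 * q ^ 2)) / (16 * q ^ 2) := by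
              field_simp
          _ ≤ n * (n * r n) / (16 * q ^ 2) := by gcongr
          _ = r n * (n / (4 * q) * (n / (4 * q))) := by field_simp; norm_num
          _ ≤ _ := by
              have := h0 n
              gcongr
    _ = Real.exp (-n) := by rw [← Real.exp_add]; ring_nf

/-- Below the threshold, the expected number of isolated vertices tends to infinity. -/
theorem tendsto_mul_one_sub_pow {r : ℕ → ℝ} (h0 : ∀ n, 0 ≤ r n)
    (hr : Tendsto (fun n : ℕ => n * r n - Real.log n) atTop atBot) :
    Tendsto (fun n : ℕ => n * (1 - r n) ^ n) atTop atTop := by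
  have hlim : Tendsto (fun n : ℕ => Real.exp (-(n * r n - Real.log n) - 2)) atTop atTop :=
    Real.tendsto_exp_atTop.comp
      (tendsto_atTop_add_const_right _ _ (tendsto_neg_atBot_atTop.comp hr))
  refine tendsto_atTop_mono' _ ?_ hlim
  -- Here `n * r ≤ log n` eventually, so `n * r ^ 2 ≤ 1 / 4`, and the second-order loss `2 * n * r ^
  -- 2` fits within the slack `2` in `hlim`.
  have hlog : ∀ᶠ n : ℕ in atTop, Real.log n ^ 2 ≤ 1 / 4 * n := by
    have := (Real.isLittleO_pow_log_id_atTop (n := 2)).comp_tendsto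
      (tendsto_natCast_atTop_atTop (R := ℝ))
    filter_upwards [this.bound (show (0 : ℝ) < 1 / 4 by norm_num)] with n hn
    simpa using hn
  filter_upwards [hlog, hr.eventually_le_atBot 0, eventually_gt_atTop 0] with n hn hrn hpos
  have hn' : (0 : ℝ) < n := by exact_mod_cast hpos
  have hx0 : 0 ≤ n * r n := mul_nonneg hn'.le (h0 n)
  have hsq : (n * r n) ^ 2 ≤ 1 / 4 * n :=
    (pow_le_pow_left₀ hx0 (by linarith) 2).trans hn
  have hr2 : n * r n ^ 2 ≤ 1 / 4 := by
    refine le_of_mul_le_mul_left ?_ hn'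
    nlinarith
  have hhalf : r n ≤ 1 / 2 := by
    have h1 : (1 : ℝ) ≤ n := by exact_mod_cast hpos
    have := h0 n
    nlinarith [sq_nonneg (r n)]
  have hexp : Real.exp (-(r n + 2 * r n ^ 2)) ≤ 1 - r n := by
    -- The product expands to `1 + r ^ 2 - 2 * r ^ 3`, so `r ≤ 1 / 2` suffices.
    have h1 : 1 ≤ (1 - r n) * (1 + (r n + 2 * r n ^ 2)) := by
      have := h0 n
      nlinarith [mul_nonneg (sq_nonneg (r n)) (sub_nonneg.2 hhalf)]
    have h2 : 1 ≤ (1 - r n) * Real.exp (r n + 2 * r n ^ 2) :=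
      h1.trans (mul_le_mul_of_nonneg_left (by linarith [Real.add_one_le_exp (r n + 2 * r n ^ 2)])
        (by linarith))
    rw [Real.exp_neg]
    exact inv_le_of_inv_le₀ (by linarith) <| by
      rwa [inv_le_iff_one_le_mul₀' (by linarith)]
  calc Real.exp (-(n * r n - Real.log n) - 2)
      ≤ Real.exp (Real.log n + n * -(r n + 2 * r n ^ 2)) := Real.exp_le_exp.2 (by linarith)
    _ = n * Real.exp (-(r n + 2 * r n ^ 2)) ^ n := by
        rw [Real.exp_add, Real.exp_log hn', Real.exp_nat_mul]
    _ ≤ n * (1 - r n) ^ n := by gcongr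

end Asymptotics

/-! ### Both sides of the threshold -/

section Threshold

variable {q : ℕ} {α : Fin q → ℝ}

theorem tendsto_fullProfile_one (hα : ∀ i, 0 < α i) (hsum : ∑ i, α i = 1) {αmin : ℝ}
    (hmin : IsLeast (Set.range α) αmin) (p : ℕ → I)
    (hp : Tendsto (fun n : ℕ => αmin * n * (p n : ℝ) - Real.log n) atTop atTop) :
    Tendsto (fun n => (coloredGnnp n (p n) α).real (fullProfile n q)) atTop (𝓝 1) := by
  obtain ⟨⟨i₀, -⟩, hle⟩ := hmin
  have hq : 0 < q := i₀.pos
  have hα1 : ∀ i, α i ≤ 1 := fun i =>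
    hsum ▸ Finset.single_le_sum (fun j _ => (hα j).le) (Finset.mem_univ i)
  have h0 : ∀ i n, 0 ≤ p n * α i := fun i n => mul_nonneg (p n).2.1 (hα i).le
  have h1 : ∀ i n, p n * α i ≤ 1 := fun i n => mul_le_one₀ (p n).2.2 (hα i).le (hα1 i)
  have hx : ∀ i, Tendsto (fun n : ℕ => (n : ℝ) * (p n * α i) - Real.log n) atTop atTop := fun i => by
    refine tendsto_atTop_mono (fun n => ?_) hp
    have : αmin * (n * (p n : ℝ)) ≤ α i * (n * (p n : ℝ)) :=
      mul_le_mul_of_nonneg_right (hle ⟨i, rfl⟩) (mul_nonneg n.cast_nonneg (p n).2.1)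
    linarith
  have hx' : ∀ i, Tendsto (fun n : ℕ => (n : ℝ) * (p n * α i)) atTop atTop := fun i =>
    ((hx i).atTop_add_atTop tendsto_log_natCast_atTop).congr fun n => by ring
  -- Small enough for the pigeonhole `3 * s * q < n + q` once `n > 8 * q`, and for `4 * (s - 1) ≤ n`
  -- in the obstruction bound; still linear in `n`, as hole-freeness requires.
  let s : ℕ → ℕ := fun n => n / (4 * q) + 1
  let B : ℕ → Fin q → ℝ := fun n i => 4 ^ n * (1 - p n * α i) ^ (s n * s n) +
    2 * (n * Real.exp (-(n * (p n * α i))) +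
      2 * ((2 * Real.exp 1 * (n * (p n * α i))) ^ 2 * Real.exp (-(n * (p n * α i)) / 2)))
  have hB : Tendsto (fun n => 1 - ∑ i, B n i) atTop (𝓝 1) := by
    have : ∀ i, Tendsto (fun n => B n i) atTop (𝓝 0) := fun i => by
      simpa using (tendsto_hole_bound hq (h0 i) (h1 i) (hx' i)).add
        (((tendsto_mul_exp_neg (hx i)).add
          ((tendsto_sq_mul_exp_neg_half (hx' i)).const_mul 2)).const_mul 2)
    simpa using (tendsto_finsetSum Finset.univ fun i _ => this i).const_sub 1
  refine tendsto_of_tendsto_of_tendsto_of_le_of_le' hB tendsto_const_nhds ?_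
    (Eventually.of_forall fun n => ?_)
  · have hlarge : ∀ i, ∀ᶠ n : ℕ in atTop, (n : ℝ) ≤ Real.exp (n * (p n * α i)) ∧
        (2 * Real.exp 1 * (n * (p n * α i))) ^ 2 * Real.exp (-(n * (p n * α i)) / 2) ≤ 1 / 2 :=
      fun i => by
        filter_upwards [(hx i).eventually_ge_atTop 0, eventually_gt_atTop 0,
          (tendsto_sq_mul_exp_neg_half (hx' i)).eventually_le_const
            (show (0 : ℝ) < 1 / 2 by norm_num)] with n hn hpos hy
        refine ⟨?_, hy⟩
        rw [← Real.log_le_iff_le_exp (by exact_mod_cast hpos)]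
        linarith
    filter_upwards [eventually_all.2 hlarge, eventually_gt_atTop (8 * q)] with n hn hnq
    have := isProbabilityMeasure_coloredGnnp (n := n) hα hsum (p n)
    have hbox : ∀ i, BoxBound (coloredGnnp n (p n) α) (fun G => colorRel G i) (p n * α i) :=
      fun i F₁ F₂ hF => (coloredGnnp_real_box hα hsum (p n) i hF).le
    have hdiv : n / (4 * q) * (4 * q) ≤ n := Nat.div_mul_le_self _ _
    have hN : 4 * (n / (4 * q)) ≤ n := by nlinarith
    have hsn : 3 * s n * q < n + q := by
      simp only [s]
      nlinarith
    have hsub : (fullProfile n q)ᶜ ⊆ ⋃ i ∈ (Finset.univ : Finset (Fin q)),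
        ({G | ¬ HoleFree (colorRel G i) (s n)} ∪ {G | HoleFree (colorRel G i) (s n) ∧
          ¬ ∃ ρ : Equiv.Perm (Fin n), ∀ a, colorRel G i a (ρ a)}) := by
      intro G hG
      by_contra hcon
      simp only [Finset.mem_univ, Set.iUnion_true, Set.mem_iUnion, Set.mem_union,
        Set.mem_ofPred_eq, not_exists, not_or, not_and, not_not] at hcon
      refine hG (mem_fullProfile (Nat.succ_pos _) hsn (fun i => (hcon i).1) fun i => ?_)
      have := (hcon i).2 (hcon i).1
      push Not at this
      exact this
    have hcompl : (coloredGnnp n (p n) α).real (fullProfile n q)ᶜ ≤ ∑ i, B n i := by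
      refine (measureReal_mono hsub (measure_ne_top _ _)).trans
        ((measureReal_biUnion_finset_le _ _).trans (Finset.sum_le_sum fun i _ => ?_))
      refine (measureReal_union_le _ _).trans (add_le_add ?_ ?_)
      · exact (hbox i).not_holeFree_le (h0 i n) (h1 i n) _
      · exact (hbox i).no_matching_le (h0 i n) (h1 i n) hN (hn i).1 (hn i).2
    rw [probReal_compl_eq_one_sub .of_discrete] at hcompl
    linarith
  · have := isProbabilityMeasure_coloredGnnp (n := n) hα hsum (p n)
    exact measureReal_le_one

/-- A full profile leaves no vertex isolated in the rarest color. On the first class alone these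
events are independent, so the exact probability `(1 - (1 - r) ^ n) ^ n` replaces a second-moment
argument. -/
theorem tendsto_fullProfile_zero (hα : ∀ i, 0 < α i) (hsum : ∑ i, α i = 1) {αmin : ℝ}
    (hmin : IsLeast (Set.range α) αmin) (p : ℕ → I)
    (hp : Tendsto (fun n : ℕ => αmin * n * (p n : ℝ) - Real.log n) atTop atBot) :
    Tendsto (fun n => (coloredGnnp n (p n) α).real (fullProfile n q)) atTop (𝓝 0) := by
  obtain ⟨⟨i, rfl⟩, -⟩ := hmin
  have hα1 : α i ≤ 1 := hsum ▸ Finset.single_le_sum (fun j _ => (hα j).le) (Finset.mem_univ i)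
  have h0 : ∀ n, 0 ≤ p n * α i := fun n => mul_nonneg (p n).2.1 (hα i).le
  have h1 : ∀ n, p n * α i ≤ 1 := fun n => mul_le_one₀ (p n).2.2 (hα i).le hα1
  have hlim := tendsto_mul_one_sub_pow h0 (hp.congr fun n => by ring)
  refine squeeze_zero (fun n => measureReal_nonneg) (fun n => ?_)
    (Real.tendsto_exp_neg_atTop_nhds_zero.comp hlim)
  have := isProbabilityMeasure_coloredGnnp (n := n) hα hsum (p n)
  have hsub : fullProfile n q ⊆ {G | ∀ a, ∃ b, colorRel G i a b} := fun G hG a => by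
    obtain ⟨ρ, hρ⟩ := exists_monochromatic_of_mem_fullProfile hG i
    exact ⟨ρ a, hρ a⟩
  refine (measureReal_mono hsub (measure_ne_top _ _)).trans ?_
  rw [coloredGnnp_real_forall_exists hα hsum]
  refine (one_sub_pow_le_exp (pow_le_one₀ (by linarith [h1 n]) (by linarith [h0 n])) n).trans_eq ?_
  simp [mul_comm]

end Threshold

end MatchingProfile

theorem theorem2 {q : ℕ} (α : Fin q → ℝ) (hα : ∀ i, 0 < α i) (hsum : ∑ i, α i = 1)
    (αmin : ℝ) (hmin : IsLeast (Set.range α) αmin) :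
    -- the full profile appears w.h.p. at `p = (log n + ω) / (αmin n)`
    (∀ (ω : ℕ → ℝ) (p : ℕ → I),
      Tendsto ω atTop atTop →
      ω =o[atTop] (fun n : ℕ => Real.log n) →
      (∀ᶠ n : ℕ in atTop, (p n : ℝ) = (Real.log n + ω n) / (αmin * n)) →
      Tendsto (fun n => (MatchingProfile.coloredGnnp n (p n) α).real
        (MatchingProfile.fullProfile n q)) atTop (𝓝 1)) ∧
    -- hence it appears w.h.p. whenever `αmin n p - log n → ∞`
    (∀ p : ℕ → I,
      Tendsto (fun n : ℕ => αmin * n * (p n : ℝ) - Real.log n) atTop atTop →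
      Tendsto (fun n => (MatchingProfile.coloredGnnp n (p n) α).real
        (MatchingProfile.fullProfile n q)) atTop (𝓝 1)) ∧
    -- and w.h.p. it does not appear whenever `αmin n p - log n → -∞`
    (∀ p : ℕ → I,
      Tendsto (fun n : ℕ => αmin * n * (p n : ℝ) - Real.log n) atTop atBot →
      Tendsto (fun n => (MatchingProfile.coloredGnnp n (p n) α).real
        (MatchingProfile.fullProfile n q)) atTop (𝓝 0)) := by
  refine ⟨fun ω p hω _ hp => ?_, MatchingProfile.tendsto_fullProfile_one hα hsum hmin,
    MatchingProfile.tendsto_fullProfile_zero hα hsum hmin⟩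
  -- For large `n`, the quantity `αmin * n * p n - log n` is exactly `ω n`.
  refine MatchingProfile.tendsto_fullProfile_one hα hsum hmin p (hω.congr' ?_)
  obtain ⟨i, rfl⟩ := hmin.1
  filter_upwards [hp, eventually_gt_atTop 0] with n hn hpos
  have hn' : (0 : ℝ) < n := by exact_mod_cast hpos
  rw [hn, mul_div_cancel₀ _ (mul_pos (hα i) hn').ne']
  ring
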